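/- Theorem 5. Let $G$ be a 3-dimensional real Lie group with Lie algebra $\mathfrak g$. Let $(\Pi, g)$ be a left-invariant sub-Riemannian structure on $G$, given by a 2-dimensional subspace $\Pi \subset \mathfrak g$ and a positive definite inner product $g$ on $\Pi$, and suppose that the left-invariant distribution defined by $\Pi$ is contact, that is, $\alpha \wedge d\alpha \neq 0$ for every nonzero left-invariant 1-form $\alpha$ that annihilates $\Pi$. Let $H : T^*G \to \mathbb R$ be the Hamiltonian of the geodesic flow, $H = \tfrac12(\xi_1^2 + \xi_2^2)$, where $\xi_1, \xi_2$ is a $g$-orthonormal basis of $\Pi$ and the corresponding left-invariant vector fields are regarded as fibrewise linear functions on $T^*G$. Then the sub-Riemannian geodesic flow is $C^\omega$-integrable in the Liouville sense: there are real-analytic functions $I_1 = H, I_2, I_3$ on $T^*G$ with $\{I_j, I_k\} = 0$ for all $j, k$, where $\{\cdot,\cdot\}$ is the Poisson bracket of the standard symplectic form of $T^*G$, such that $dI_1, dI_2, dI_3$ are linearly independent outside a set of measure zero. -/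

import Mathlib

open scoped Manifold ContDiff

noncomputable section

/-! ### The cotangent bundle and its canonical Poisson bracket -/

section Cotangent

variable (E : Type*) [NormedAddCommGroup E] [NormedSpace ℝ E]
  (M : Type*) [TopologicalSpace M] [ChartedSpace E M] [IsManifold 𝓘(ℝ, E) ω M]

/-- The cotangent bundle `T*M` of a real-analytic manifold `M` modelled on `E`, with points
`z = ⟨q, p⟩`, where `p` is a covector at `q = z.proj`. Mathlib's bundle of continuous linear maps
makes it a real-analytic manifold modelled on `E × E*`. -/
abbrev CotangentBundle : Type _ :=
  Bundle.TotalSpace (E →L[ℝ] ℝ)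
    (fun q : M => TangentSpace 𝓘(ℝ, E) q →L[ℝ] Bundle.Trivial M ℝ q)

/-- The model with corners of the cotangent bundle. -/
abbrev cotangentModel : ModelWithCorners ℝ (E × (E →L[ℝ] ℝ)) (ModelProd E (E →L[ℝ] ℝ)) :=
  𝓘(ℝ, E).prod 𝓘(ℝ, E →L[ℝ] ℝ)

variable {E M}

/-- The differential `dF` at `z ∈ T*M`, in the canonical coordinates `(q, p) ∈ E × E*` on `T*M`
which are induced by the preferred chart of `M` at the base point of `z`. -/
def cotangentDifferential (F : CotangentBundle E M → ℝ) (z : CotangentBundle E M) :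
    (E × (E →L[ℝ] ℝ)) →L[ℝ] ℝ :=
  mfderiv (cotangentModel E) 𝓘(ℝ) F z

/-- The partial differential `∂F/∂q ∈ E*` in canonical coordinates. -/
def partialQ (F : CotangentBundle E M → ℝ) (z : CotangentBundle E M) : E →L[ℝ] ℝ :=
  (cotangentDifferential F z).comp (ContinuousLinearMap.inl ℝ E (E →L[ℝ] ℝ))

/-- The partial differential `∂F/∂p ∈ E**` in canonical coordinates. -/
def partialP (F : CotangentBundle E M → ℝ) (z : CotangentBundle E M) :
    (E →L[ℝ] ℝ) →L[ℝ] ℝ :=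
  (cotangentDifferential F z).comp (ContinuousLinearMap.inr ℝ E (E →L[ℝ] ℝ))

/-- The Poisson bracket of the standard symplectic form `∑ dqⁱ ∧ dpᵢ` on `T*M`, that is
`{F, G} = ∑ᵢ (∂F/∂qⁱ ∂G/∂pᵢ - ∂F/∂pᵢ ∂G/∂qⁱ)` in canonical coordinates. -/
def poissonBracket (F G : CotangentBundle E M → ℝ) (z : CotangentBundle E M) : ℝ :=
  partialP G z (partialQ F z) - partialP F z (partialQ G z)

/-- A subset of `T*M` has measure zero if its image in each of the preferred charts has
(Lebesgue) measure zero. -/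
def IsNullSet [FiniteDimensional ℝ E] [MeasurableSpace E] [BorelSpace E]
    (S : Set (CotangentBundle E M)) : Prop :=
  ∀ z : CotangentBundle E M,
    (MeasureTheory.Measure.addHaar : MeasureTheory.Measure (E × (E →L[ℝ] ℝ)))
      (extChartAt (cotangentModel E) z '' (S ∩ (extChartAt (cotangentModel E) z).source)) = 0

/-- The Hamiltonian system on `T*M` with Hamiltonian `H` is `C^ω`-integrable in the Liouville
sense: there are `n = dim M` real-analytic functions `I 0 = H, I 1, …, I (n - 1)` on `T*M` which
pairwise Poisson-commute (so all of them are first integrals) and whose differentials are linearly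
independent outside a set of measure zero. -/
def IsAnalyticallyIntegrable [FiniteDimensional ℝ E] [MeasurableSpace E] [BorelSpace E]
    (H : CotangentBundle E M → ℝ) : Prop :=
  ∃ I : ℕ → CotangentBundle E M → ℝ,
    I 0 = H ∧
    (∀ i < Module.finrank ℝ E, ContMDiff (cotangentModel E) 𝓘(ℝ) ω (I i)) ∧
    (∀ i < Module.finrank ℝ E, ∀ j < Module.finrank ℝ E, ∀ z, poissonBracket (I i) (I j) z = 0) ∧
    IsNullSet {z : CotangentBundle E M |
      ¬ LinearIndependent ℝ
        (fun i : Fin (Module.finrank ℝ E) => cotangentDifferential (I i) z)}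

end Cotangent

/-! ### Left-invariant sub-Riemannian structures on Lie groups -/

section LieGroups

variable (E : Type*) [NormedAddCommGroup E] [NormedSpace ℝ E]
  (G : Type*) [TopologicalSpace G] [ChartedSpace E G] [Group G]

/-- A left-invariant sub-Riemannian structure `(Π, g)` on a Lie group, presented on its Lie
algebra: a subspace `Π` with a positive definite inner product. At a point `a` of the group the
distribution consists of the values at `a` of the left-invariant vector fields of the elements of
`Π`, and the inner product is the one for which `Π → Π_a` is an isometry. -/
structure LeftInvariantSubRiemannian where
  /-- The distribution at the identity. -/
  plane : Submodule ℝ (GroupLieAlgebra 𝓘(ℝ, E) G)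
  /-- The metric on the distribution at the identity. -/
  metric : LinearMap.BilinForm ℝ plane
  metric_symm : ∀ v w, metric v w = metric w v
  metric_pos : ∀ v, v ≠ 0 → 0 < metric v v

variable {E G}

namespace LeftInvariantSubRiemannian

theorem nondegenerate (S : LeftInvariantSubRiemannian E G) : S.metric.Nondegenerate := by
  have key : ∀ v, S.metric v v = 0 → v = 0 := fun v hv => by
    by_contra h
    exact (S.metric_pos v h).ne' hv
  exact ⟨fun v hv => key v (hv v), fun v hv => key v (hv v)⟩

/-- The Chevalley–Eilenberg differential of a covector `α` on the Lie algebra, i.e. the exterior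
derivative of the left-invariant 1-form `α`: `dα(u, v) = -α([u, v])`. -/
def dForm (α : Module.Dual ℝ (GroupLieAlgebra 𝓘(ℝ, E) G)) (u v : GroupLieAlgebra 𝓘(ℝ, E) G) : ℝ :=
  -α ⁅u, v⁆

/-- The left-invariant 3-form `α ∧ dα`. -/
def contactForm (α : Module.Dual ℝ (GroupLieAlgebra 𝓘(ℝ, E) G))
    (u v w : GroupLieAlgebra 𝓘(ℝ, E) G) : ℝ :=
  α u * dForm α v w + α v * dForm α w u + α w * dForm α u v

/-- The distribution is a contact distribution of rank two (on a group of dimension three):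
`α ∧ dα ≠ 0` for every nonzero `α` in the annihilator of `Π`. By left-invariance it is enough to
look at left-invariant forms. -/
def IsContact (S : LeftInvariantSubRiemannian E G) : Prop :=
  Module.finrank ℝ S.plane = 2 ∧
    ∀ α : Module.Dual ℝ (GroupLieAlgebra 𝓘(ℝ, E) G), α ≠ 0 → (∀ v ∈ S.plane, α v = 0) →
      ∃ u v w, contactForm α u v w ≠ 0

variable [LieGroup 𝓘(ℝ, E) ω G]

/-- The restriction map `T*G → Π*`, with the fibre of the distribution at the base point `a`
identified with `Π` by left translation. -/
def restrict (S : LeftInvariantSubRiemannian E G) (z : CotangentBundle E G) :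
    Module.Dual ℝ S.plane where
  toFun v := z.2 (mulInvariantVectorField (I := 𝓘(ℝ, E)) (v : GroupLieAlgebra 𝓘(ℝ, E) G) z.1)
  map_add' v w := by
    rw [Submodule.coe_add, mulInvariantVectorField_add]
    exact map_add z.2 _ _
  map_smul' c v := by
    rw [Submodule.coe_smul, mulInvariantVectorField_smul]
    exact map_smul z.2 _ _

/-- The isomorphism `♯ : Π* → Π` defined by the metric. -/
def sharp (S : LeftInvariantSubRiemannian E G) [FiniteDimensional ℝ S.plane] :
    Module.Dual ℝ S.plane ≃ₗ[ℝ] S.plane :=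
  (S.metric.toDual S.nondegenerate).symm

/-- The Hamiltonian of the (normal) sub-Riemannian geodesic flow: the composition of
`T*G → Π*`, of `♯ : Π* → Π` and of `v ↦ ½ ‖v‖²`. -/
def hamiltonian [FiniteDimensional ℝ E] (S : LeftInvariantSubRiemannian E G)
    (z : CotangentBundle E G) : ℝ :=
  haveI : FiniteDimensional ℝ (GroupLieAlgebra 𝓘(ℝ, E) G) := inferInstanceAs (FiniteDimensional ℝ E)
  1 / 2 * S.metric (S.sharp (S.restrict z)) (S.sharp (S.restrict z))

end LeftInvariantSubRiemannian

end LieGroups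

end

/-! A vector `v` of the Lie algebra gives two fibrewise linear functions on the cotangent bundle,
the momenta of its left- and right-invariant fields. The bracket of two momenta is minus the
momentum of the Lie bracket (`poissonBracket_momentum`). Left and right translations commute, so
every left momentum commutes with every right one (`canonicalPoisson_left_right`). The Hamiltonian
`H` is a quadratic polynomial in the left momenta of an orthonormal frame `x`, `y` of the plane,
hence all right momenta are first integrals. They need not commute with each other, so the two
missing integrals depend on the algebra.

The contact condition makes `x`, `y`, `z = ⁅x, y⁆` a basis, and the Jacobi identity leaves two cases
(`exists_commuting_pair_or_unimodular`). Either two independent vectors `u`, `v` commute, and their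
right momenta complete `H`; or the matrix of structure constants is symmetric, the corresponding
quadratic form in the left momenta is a Casimir function, and this Casimir together with the right
momentum of `x` completes `H`.

Independence is tested by pairing a linear relation between differentials with a further momentum,
and by restricting it to the fibre directions. It can fail only where one of finitely many momenta
of nowhere vanishing fields is zero. Such a zero set is a hyperplane in each fibre, hence null by
Fubini (`isNullSet_momentum_eq_zero`). -/

noncomputable section

open Bundle VectorField Set Filter Topology

/-! ### Momenta of vector fields and their Poisson brackets -/

section Momentum

variable {E : Type*} [NormedAddCommGroup E] [NormedSpace ℝ E]
  {M : Type*} [TopologicalSpace M] [ChartedSpace E M]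

/-- The fibrewise linear function on `T*M` defined by a vector field. -/
def momentum (V : Π q : M, TangentSpace 𝓘(ℝ, E) q) (z : CotangentBundle E M) : ℝ :=
  z.2 (V z.1)

/-- The covector of a point of `T*M`, in the model space of the fibres. -/
def covector (z : CotangentBundle E M) : E →L[ℝ] ℝ := z.2

/-- The value of a vector field, in the model space of the fibres. -/
def fieldValue (V : Π q : M, TangentSpace 𝓘(ℝ, E) q) (q : M) : E := V q

theorem momentum_eq (V : Π q : M, TangentSpace 𝓘(ℝ, E) q) (z : CotangentBundle E M) :
    momentum V z = covector z (fieldValue V z.1) := rfl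

/-- A vector field read in the preferred chart at `q₀`. -/
def chartField (V : Π q : M, TangentSpace 𝓘(ℝ, E) q) (q₀ : M) : E → E :=
  mpullbackWithin 𝓘(ℝ, E) 𝓘(ℝ, E) (extChartAt 𝓘(ℝ, E) q₀).symm V (range 𝓘(ℝ, E))

variable [IsManifold 𝓘(ℝ, E) ω M]

theorem chartField_self (V : Π q : M, TangentSpace 𝓘(ℝ, E) q) (q₀ : M) :
    chartField V q₀ (extChartAt 𝓘(ℝ, E) q₀ q₀) = fieldValue V q₀ := by
  have := mfderivWithin_extChartAt_symm_inverse_apply (I := 𝓘(ℝ, E)) (M := M)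
    (x := q₀) (V q₀)
  rw [chartField, mpullbackWithin_apply]
  have h2 : (V ((extChartAt 𝓘(ℝ, E) q₀).symm (extChartAt 𝓘(ℝ, E) q₀ q₀)) : E) = V q₀ := by
    rw [extChartAt_to_inv q₀]
  refine Eq.trans ?_ this
  exact congrArg _ h2

theorem differentiableAt_chartField [CompleteSpace E] {V : Π q : M, TangentSpace 𝓘(ℝ, E) q} {q₀ : M}
    (hV : MDiffAt (T% V) q₀) :
    DifferentiableAt ℝ (chartField V q₀) (extChartAt 𝓘(ℝ, E) q₀ q₀) := by
  have := (mdifferentiableWithinAt_univ.2 hV).differentiableWithinAt_mpullbackWithin_vectorField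
  rw [← differentiableWithinAt_univ]
  refine (DifferentiableWithinAt.mono this ?_)
  intro x _
  simp only [preimage_univ, modelWithCornersSelf_coe, range_id, inter_self, mem_univ]

theorem extChartAt_cotangent_fst (z w : CotangentBundle E M) :
    (extChartAt (cotangentModel E) z w).1 = extChartAt 𝓘(ℝ, E) z.1 w.1 := by
  rfl

theorem mem_extChartAt_cotangent_source {z w : CotangentBundle E M} :
    w ∈ (extChartAt (cotangentModel E) z).source ↔ w.1 ∈ (chartAt E z.1).source := by
  rw [extChartAt_source, FiberBundle.chartedSpace_chartAt]
  constructor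
  · intro h
    have h' := h.2
    simp only [mfld_simps] at h'
    exact h'
  · intro h
    simp [hom_trivializationAt_source, h]

/-- The cotangent chart composes a covector with the derivative of the inverse base chart, while
`chartField` applies the inverse of that derivative; the two cancel in the pairing. -/
theorem momentum_eq_extChartAt (V : Π q : M, TangentSpace 𝓘(ℝ, E) q) {z w : CotangentBundle E M}
    (hw : w ∈ (extChartAt (cotangentModel E) z).source) :
    momentum V w = (extChartAt (cotangentModel E) z w).2
      (chartField V z.1 (extChartAt (cotangentModel E) z w).1) := by
  rw [mem_extChartAt_cotangent_source] at hw
  have h1 : (extChartAt (cotangentModel E) z w).2 =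
    ContinuousLinearMap.inCoordinates E (TangentSpace 𝓘(ℝ, E)) ℝ (Bundle.Trivial M ℝ)
      z.1 w.1 z.1 w.1 w.2 := by
    have := hom_chart (HB := E) (B := M) z w
    exact congrArg Prod.snd this
  have h2 := TangentBundle.symmL_trivializationAt (I := 𝓘(ℝ, E)) (M := M) (x₀ := z.1) hw
  have hw' : w.1 ∈ (extChartAt 𝓘(ℝ, E) z.1).source := by simpa using hw
  have h3 := isInvertible_mfderivWithin_extChartAt_symm (I := 𝓘(ℝ, E)) (M := M)
    ((extChartAt 𝓘(ℝ, E) z.1).map_source hw')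
  have h4 : (V ((extChartAt 𝓘(ℝ, E) z.1).symm (extChartAt 𝓘(ℝ, E) z.1 w.1)) : E) = V w.1 := by
    rw [(extChartAt 𝓘(ℝ, E) z.1).left_inv hw']
  rw [h1, extChartAt_cotangent_fst, ContinuousLinearMap.inCoordinates, h2]
  have h6 : (mfderivWithin 𝓘(ℝ, E) 𝓘(ℝ, E) (extChartAt 𝓘(ℝ, E) z.1).symm
      (range 𝓘(ℝ, E)) (extChartAt 𝓘(ℝ, E) z.1 w.1) : E →L[ℝ] E)
      (chartField (E := E) V z.1 (extChartAt 𝓘(ℝ, E) z.1 w.1)) = V w.1 :=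
    Eq.trans (h3.self_apply_inverse _) h4
  have h7 := congrArg w.2 h6
  have h8 : (trivializationAt ℝ (Bundle.Trivial M ℝ) z.1).continuousLinearMapAt ℝ w.1 =
      ContinuousLinearMap.id ℝ ℝ :=
    Bundle.Trivial.continuousLinearMapAt_trivialization ℝ M ℝ w.1
  rw [h8]
  exact h7.symm

theorem contMDiff_momentum {V : Π q : M, TangentSpace 𝓘(ℝ, E) q}
    (hV : CMDiff ω (T% V)) : ContMDiff (cotangentModel E) 𝓘(ℝ) ω (momentum V) := by
  intro z
  have h := ContMDiffAt.clm_bundle_apply (n := ω) (IB := 𝓘(ℝ, E)) (IM := cotangentModel E)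
    (E₁ := fun q : M => TangentSpace 𝓘(ℝ, E) q) (E₂ := Bundle.Trivial M ℝ) (F₁ := E) (F₂ := ℝ)
    (b := fun w : CotangentBundle E M => w.1) (ϕ := fun w => w.2) (v := fun w => V w.1) (x := z)
    contMDiffAt_id ((hV.comp (contMDiff_proj _)) z)
  rw [contMDiffAt_totalSpace] at h
  exact h.2

theorem extChartAt_cotangent_self_snd (z : CotangentBundle E M) :
    (extChartAt (cotangentModel E) z z).2 = covector z := by
  ext v
  -- No regularity is needed: only the value of this field at the base point enters.
  let V : Π q : M, TangentSpace 𝓘(ℝ, E) q := fun _ => v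
  have h := momentum_eq_extChartAt V (mem_extChartAt_source (I := cotangentModel E) z)
  rw [extChartAt_cotangent_fst, chartField_self] at h
  exact h.symm

theorem cotangentDifferential_momentum [CompleteSpace E] {V : Π q : M, TangentSpace 𝓘(ℝ, E) q}
    {z : CotangentBundle E M} (hV : MDiffAt (T% V) z.1) (u : E) (η : E →L[ℝ] ℝ) :
    cotangentDifferential (momentum V) z (u, η) =
      covector z (fderiv ℝ (chartField V z.1) (extChartAt 𝓘(ℝ, E) z.1 z.1) u) +
        η (fieldValue V z.1) := by
  have hD : HasFDerivAt (chartField V z.1)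
      (fderiv ℝ (chartField V z.1) (extChartAt 𝓘(ℝ, E) z.1 z.1))
      (extChartAt (cotangentModel E) z z).1 := (differentiableAt_chartField hV).hasFDerivAt
  have hG := HasFDerivAt.clm_apply
    (hasFDerivAt_snd (𝕜 := ℝ) (p := extChartAt (cotangentModel E) z z))
    (hD.comp _ hasFDerivAt_fst)
  have hc := (mdifferentiableAt_extChartAt (I := cotangentModel E)
    (mem_chart_source _ z)).hasMFDerivAt
  rw [mfderiv_extChartAt_self] at hc
  have h := hG.hasMFDerivAt.comp z hc
  have h2 := h.congr_of_eventuallyEq (f₁ := momentum V) (by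
    filter_upwards [extChartAt_source_mem_nhds (I := cotangentModel E) z] with w hw
    exact momentum_eq_extChartAt V hw)
  rw [cotangentDifferential, h2.mfderiv, Function.comp_apply, extChartAt_cotangent_self_snd,
    extChartAt_cotangent_fst, chartField_self]
  rfl

theorem partialP_momentum [CompleteSpace E] {V : Π q : M, TangentSpace 𝓘(ℝ, E) q}
    {z : CotangentBundle E M} (hV : MDiffAt (T% V) z.1) (η : E →L[ℝ] ℝ) :
    partialP (momentum V) z η = η (fieldValue V z.1) := by
  refine (cotangentDifferential_momentum hV 0 η).trans ?_
  rw [map_zero, map_zero, zero_add]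

theorem partialQ_momentum [CompleteSpace E] {V : Π q : M, TangentSpace 𝓘(ℝ, E) q}
    {z : CotangentBundle E M} (hV : MDiffAt (T% V) z.1) :
    partialQ (momentum V) z = (covector z).comp
      (fderiv ℝ (chartField V z.1) (extChartAt 𝓘(ℝ, E) z.1 z.1)) := by
  ext u
  refine (cotangentDifferential_momentum hV u 0).trans ?_
  rw [zero_apply, add_zero]
  rfl

theorem fieldValue_mlieBracket (V W : Π q : M, TangentSpace 𝓘(ℝ, E) q) (q : M) :
    fieldValue (mlieBracket 𝓘(ℝ, E) V W) q =
      fderiv ℝ (chartField W q) (extChartAt 𝓘(ℝ, E) q q) (fieldValue V q) -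
        fderiv ℝ (chartField V q) (extChartAt 𝓘(ℝ, E) q q) (fieldValue W q) := by
  rw [← chartField_self V, ← chartField_self W]
  have h : (extChartAt 𝓘(ℝ, E) q).symm ⁻¹' univ ∩ range 𝓘(ℝ, E) = univ := by simp
  have h2 := lieBracket_eq (𝕜 := ℝ) (V := chartField V q) (W := chartField W q)
  rw [← lieBracketWithin_univ] at h2
  refine Eq.trans ?_ (congrFun h2 _)
  rw [fieldValue, mlieBracket, mlieBracketWithin_apply, mfderiv_extChartAt_self, h]
  exact DFunLike.congr_fun (ContinuousLinearMap.inverse_id (R := ℝ) (M := E)) _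

/-- In the chart at the base point both sides are the covector applied to a commutator of
derivatives. The minus sign comes from the convention `{q, p} = 1`. -/
theorem poissonBracket_momentum [CompleteSpace E] {V W : Π q : M, TangentSpace 𝓘(ℝ, E) q}
    {z : CotangentBundle E M} (hV : MDiffAt (T% V) z.1) (hW : MDiffAt (T% W) z.1) :
    poissonBracket (momentum V) (momentum W) z = -momentum (mlieBracket 𝓘(ℝ, E) V W) z := by
  rw [poissonBracket, partialP_momentum hW, partialP_momentum hV, partialQ_momentum hV,
    partialQ_momentum hW, momentum_eq, fieldValue_mlieBracket, map_sub]
  simp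

theorem chartField_ne_zero {V : Π q : M, TangentSpace 𝓘(ℝ, E) q} (hV : ∀ q, V q ≠ 0)
    {q₀ : M} {x : E} (hx : x ∈ (extChartAt 𝓘(ℝ, E) q₀).target) : chartField V q₀ x ≠ 0 := by
  intro h
  have h3 := isInvertible_mfderivWithin_extChartAt_symm (I := 𝓘(ℝ, E)) (M := M) hx
  have h4 := h3.self_apply_inverse (V ((extChartAt 𝓘(ℝ, E) q₀).symm x))
  refine hV _ (h4.symm.trans ?_)
  exact (congrArg _ h).trans (map_zero _)

end Momentum

/-! ### Null sets in the cotangent bundle -/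

section NullSet

open MeasureTheory

variable {E : Type*} [NormedAddCommGroup E] [NormedSpace ℝ E] [FiniteDimensional ℝ E]
  [MeasurableSpace E] [BorelSpace E]
  {M : Type*} [TopologicalSpace M] [ChartedSpace E M] [IsManifold 𝓘(ℝ, E) ω M]

theorem IsNullSet.mono {S T : Set (CotangentBundle E M)} (hT : IsNullSet T) (h : S ⊆ T) :
    IsNullSet S :=
  fun z => measure_mono_null (image_mono (inter_subset_inter_left _ h)) (hT z)

theorem IsNullSet.union {S T : Set (CotangentBundle E M)} (hS : IsNullSet S) (hT : IsNullSet T) :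
    IsNullSet (S ∪ T) := by
  intro z
  rw [union_inter_distrib_right, image_union]
  exact measure_union_null (hS z) (hT z)

/-- A measurable set in `E × E*` all of whose slices are contained in hyperplanes has measure
zero. -/
theorem addHaar_eq_zero_of_slices {T : Set (E × (E →L[ℝ] ℝ))} (hT : MeasurableSet T) (v : E → E)
    (hv : ∀ y ∈ T, v y.1 ≠ 0 ∧ y.2 (v y.1) = 0) :
    (Measure.addHaar : Measure (E × (E →L[ℝ] ℝ))) T = 0 := by
  -- Passing to the product measure makes Fubini available: it suffices that the slices over almost
  -- every base point are null.
  have : Measure.addHaar ≪ (Measure.addHaar : Measure E).prod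
    (Measure.addHaar : Measure (E →L[ℝ] ℝ)) := Measure.absolutelyContinuous_isAddHaarMeasure _ _
  apply this
  rw [Measure.measure_prod_null hT]
  filter_upwards with x
  by_cases hx : v x = 0
  · have h : Prod.mk x ⁻¹' T = ∅ := eq_empty_of_forall_notMem fun p hp => (hv _ hp).1 hx
    rw [h, measure_empty]
    rfl
  · let L : (E →L[ℝ] ℝ) →ₗ[ℝ] ℝ := (ContinuousLinearMap.apply ℝ ℝ (v x)).toLinearMap
    refine measure_mono_null (t := (L.ker : Set (E →L[ℝ] ℝ))) (fun p hp => (hv _ hp).2)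
      (Measure.addHaar_submodule _ _ ?_)
    -- The kernel of evaluation at `v x` is proper, since by Hahn–Banach some functional does not
    -- vanish at `v x`.
    intro htop
    obtain ⟨p, hp⟩ := exists_dual_vector ℝ (v x) (norm_ne_zero_iff.2 hx)
    have : p ∈ L.ker := htop ▸ Submodule.mem_top
    have h2 : p (v x) = 0 := this
    rw [hp.2] at h2
    simp [hx] at h2

theorem isNullSet_momentum_eq_zero {V : Π q : M, TangentSpace 𝓘(ℝ, E) q}
    (hV : CMDiff ω (T% V)) (hV0 : ∀ q, V q ≠ 0) :
    IsNullSet {z : CotangentBundle E M | momentum V z = 0} := by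
  intro z
  set φ := extChartAt (cotangentModel E) z with hφ
  have hopen : IsOpen φ.target := isOpen_extChartAt_target z
  have hcont : ContinuousOn (momentum V ∘ φ.symm) φ.target :=
    (contMDiff_momentum hV).continuous.comp_continuousOn (continuousOn_extChartAt_symm z)
  -- The zero set in the chart is a difference of two open sets, which gives the measurability that
  -- Fubini requires.
  have himage : φ '' ({z | momentum V z = 0} ∩ φ.source) =
      φ.target \ (φ.target ∩ (momentum V ∘ φ.symm) ⁻¹' {0}ᶜ) := by
    ext y
    constructor
    · rintro ⟨w, ⟨hw, hw'⟩, rfl⟩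
      refine ⟨φ.map_source hw', fun h => h.2 ?_⟩
      simpa [φ.left_inv hw'] using hw
    · rintro ⟨hy, hy'⟩
      refine ⟨φ.symm y, ⟨?_, φ.map_target hy⟩, φ.right_inv hy⟩
      by_contra h
      exact hy' ⟨hy, h⟩
  have hmeas : MeasurableSet (φ '' ({z | momentum V z = 0} ∩ φ.source)) := by
    rw [himage]
    exact hopen.measurableSet.diff
      (hcont.isOpen_inter_preimage hopen isOpen_compl_singleton).measurableSet
  refine addHaar_eq_zero_of_slices hmeas (chartField V z.1) ?_
  rintro _ ⟨w, ⟨hw, hw'⟩, rfl⟩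
  refine ⟨chartField_ne_zero hV0 ?_, (momentum_eq_extChartAt V hw').symm.trans hw⟩
  rw [hφ, extChartAt_cotangent_fst]
  refine (extChartAt 𝓘(ℝ, E) z.1).map_source ?_
  rw [extChartAt_source]
  exact mem_extChartAt_cotangent_source.1 hw'

end NullSet

/-! ### Left- and right-invariant vector fields -/

section InvariantFields

variable {E : Type*} [NormedAddCommGroup E] [NormedSpace ℝ E]
  {G : Type*} [TopologicalSpace G] [ChartedSpace E G]

theorem isInvertible_mfderiv_of_inverse {f g : G → G} {a : G}
    (hf : MDiffAt f a) (hg : MDiffAt g (f a)) (hgf : ∀ b, g (f b) = b) (hfg : ∀ b, f (g b) = b) :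
    (mfderiv% f a).IsInvertible := by
  have A : mfderiv% (g ∘ f) a = ContinuousLinearMap.id _ _ := by
    rw [show g ∘ f = id from funext hgf, mfderiv_id]
  have A' : mfderiv% (f ∘ g) (f a) = ContinuousLinearMap.id _ _ := by
    rw [show f ∘ g = id from funext hfg, mfderiv_id]
  rw [mfderiv_comp (I' := 𝓘(ℝ, E)) _ hg hf] at A
  rw [mfderiv_comp (I' := 𝓘(ℝ, E)) _ (by rwa [hgf]) hg, hgf] at A'
  exact ContinuousLinearMap.IsInvertible.of_inverse A' A

variable [Group G]

/-- The right-invariant vector field, up to the identification of its value at `1`, which is the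
pullback of a left-invariant one by the inversion. -/
def rightInvariantField (v : GroupLieAlgebra 𝓘(ℝ, E) G) : Π a : G, TangentSpace 𝓘(ℝ, E) a :=
  mpullback 𝓘(ℝ, E) 𝓘(ℝ, E) (fun a => a⁻¹) (mulInvariantVectorField v)


theorem rightInvariantField_add (v w : GroupLieAlgebra 𝓘(ℝ, E) G) :
    rightInvariantField (v + w) = rightInvariantField v + rightInvariantField w := by
  rw [rightInvariantField, mulInvariantVectorField_add, mpullback_add]
  rfl

theorem rightInvariantField_smul (c : ℝ) (v : GroupLieAlgebra 𝓘(ℝ, E) G) :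
    rightInvariantField (c • v) = c • rightInvariantField v := by
  rw [rightInvariantField, mulInvariantVectorField_smul, mpullback_const_smul]
  rfl

variable [LieGroup 𝓘(ℝ, E) ω G]

theorem contMDiff_omega_mulInvariantVectorField (v : GroupLieAlgebra 𝓘(ℝ, E) G) :
    CMDiff ω (T% (mulInvariantVectorField (I := 𝓘(ℝ, E)) v)) := by
  -- The field at `g` is the derivative of multiplication at `(g, 1)` applied to `(0, v)`, so it is
  -- a composition of analytic maps of tangent bundles.
  let fg : G → TangentBundle 𝓘(ℝ, E) G := fun g ↦ TotalSpace.mk' E g 0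
  have sfg : CMDiff ω fg := contMDiff_zeroSection _ _
  let fv : G → TangentBundle 𝓘(ℝ, E) G := fun _ ↦ TotalSpace.mk' E 1 v
  have sfv : CMDiff ω fv := contMDiff_const
  let F₁ : G → (TangentBundle 𝓘(ℝ, E) G × TangentBundle 𝓘(ℝ, E) G) := fun g ↦ (fg g, fv g)
  have S₁ : CMDiff ω F₁ := sfg.prodMk sfv
  let F₂ : (TangentBundle 𝓘(ℝ, E) G × TangentBundle 𝓘(ℝ, E) G) →
      TangentBundle (𝓘(ℝ, E).prod 𝓘(ℝ, E)) (G × G) :=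
    (equivTangentBundleProd 𝓘(ℝ, E) G 𝓘(ℝ, E) G).symm
  have S₂ : CMDiff ω F₂ := contMDiff_equivTangentBundleProd_symm
  let F₃ : TangentBundle (𝓘(ℝ, E).prod 𝓘(ℝ, E)) (G × G) → TangentBundle 𝓘(ℝ, E) G :=
    tangentMap% (fun (p : G × G) ↦ p.1 * p.2)
  have S₃ : CMDiff ω F₃ :=
    ContMDiff.contMDiff_tangentMap (m := ω) (contMDiff_mul 𝓘(ℝ, E) ω) le_rfl
  let S := (S₃.comp S₂).comp S₁
  convert! S with g
  · simp [F₁, F₂, F₃, fg, fv]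
  · simp only [Function.comp_apply, tangentMap, F₃, F₂, F₁, fg, fv]
    rw [mfderiv_prod_eq_add_apply ((contMDiff_mul 𝓘(ℝ, E) ω).mdifferentiableAt (by simp))]
    exact ((congrArg (· + _) (map_zero _)).trans (zero_add _)).symm

theorem isInvertible_mfderiv_mul_left (a b : G) :
    (mfderiv% (fun x : G => a * x) b).IsInvertible :=
  isInvertible_mfderiv_of_inverse (E := E) (g := fun x => a⁻¹ * x)
    ((contMDiff_mul_left (n := ω)).mdifferentiable (by simp) _)
    ((contMDiff_mul_left (n := ω)).mdifferentiable (by simp) _) (by simp) (by simp)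

theorem isInvertible_mfderiv_inv (b : G) : (mfderiv% (fun x : G => x⁻¹) b).IsInvertible :=
  isInvertible_mfderiv_of_inverse (E := E) (g := fun x => x⁻¹)
    ((contMDiff_inv 𝓘(ℝ, E) ω).mdifferentiable (by simp) _)
    ((contMDiff_inv 𝓘(ℝ, E) ω).mdifferentiable (by simp) _) (by simp) (by simp)

theorem mulInvariantVectorField_ne_zero {v : GroupLieAlgebra 𝓘(ℝ, E) G} (hv : v ≠ 0) (a : G) :
    mulInvariantVectorField (I := 𝓘(ℝ, E)) v a ≠ 0 := by
  intro h
  obtain ⟨e, he⟩ := isInvertible_mfderiv_mul_left (E := E) a (1 : G)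
  refine hv (e.injective ?_)
  exact ((DFunLike.congr_fun he v).trans h).trans (map_zero e).symm

theorem rightInvariantField_ne_zero {v : GroupLieAlgebra 𝓘(ℝ, E) G} (hv : v ≠ 0) (a : G) :
    rightInvariantField v a ≠ 0 := by
  have h := mulInvariantVectorField_ne_zero (E := E) hv a⁻¹
  obtain ⟨e, he⟩ := isInvertible_mfderiv_inv (E := E) a
  intro h0
  rw [rightInvariantField, mpullback_apply, ← he, ContinuousLinearMap.inverse_equiv] at h0
  exact h (e.symm.injective (h0.trans (map_zero _).symm))

variable [CompleteSpace E]

theorem contMDiff_rightInvariantField (v : GroupLieAlgebra 𝓘(ℝ, E) G) :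
    CMDiff ω (T% (rightInvariantField (E := E) v)) :=
  ContMDiff.mpullback_vectorField (n := ω) (contMDiff_omega_mulInvariantVectorField v)
    (contMDiff_inv 𝓘(ℝ, E) ω) (fun a => isInvertible_mfderiv_inv a) le_rfl

theorem mlieBracket_mulInvariantVectorField (v w : GroupLieAlgebra 𝓘(ℝ, E) G) :
    mlieBracket 𝓘(ℝ, E) (mulInvariantVectorField v) (mulInvariantVectorField w) =
      mulInvariantVectorField ⁅v, w⁆ :=
  (mulInvariantVector_mlieBracket v w).symm

/-- Pullback by inversion respects brackets. The usual sign for right-invariant fields is absent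
because the derivative of inversion at `1` is already built into the field. -/
theorem mlieBracket_rightInvariantField (v w : GroupLieAlgebra 𝓘(ℝ, E) G) :
    mlieBracket 𝓘(ℝ, E) (rightInvariantField v) (rightInvariantField w) =
      rightInvariantField ⁅v, w⁆ := by
  ext a
  have hd (v : GroupLieAlgebra 𝓘(ℝ, E) G) (b : G) :
      MDiffAt (T% (mulInvariantVectorField (I := 𝓘(ℝ, E)) v)) b :=
    (contMDiff_omega_mulInvariantVectorField v).mdifferentiable (by simp) b
  have h := mpullback_mlieBracket (n := ω) (x₀ := a) (hd v a⁻¹) (hd w a⁻¹)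
    ((contMDiff_inv 𝓘(ℝ, E) ω) a) le_top
  rw [mlieBracket_mulInvariantVectorField] at h
  exact h.symm

end InvariantFields

/-- If `V` and `W` are the images of the first and the second coordinate field under a map in two
variables, then they commute. -/
theorem fderiv_apply_comm_of_partials {E : Type*} [NormedAddCommGroup E] [NormedSpace ℝ E]
    {f : E × E → E} {s₀ t₀ : E} (hf : ContDiffAt ℝ ω f (s₀, t₀)) {V W : E → E} {v w : E}
    (hV : DifferentiableAt ℝ V (f (s₀, t₀))) (hW : DifferentiableAt ℝ W (f (s₀, t₀)))
    (hVf : ∀ᶠ t in 𝓝 t₀, V (f (s₀, t)) = fderiv ℝ f (s₀, t) (v, 0))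
    (hWf : ∀ᶠ s in 𝓝 s₀, W (f (s, t₀)) = fderiv ℝ f (s, t₀) (0, w)) :
    fderiv ℝ W (f (s₀, t₀)) (V (f (s₀, t₀))) = fderiv ℝ V (f (s₀, t₀)) (W (f (s₀, t₀))) := by
  have hfd : HasFDerivAt f (fderiv ℝ f (s₀, t₀)) (s₀, t₀) :=
    (hf.differentiableAt (by simp)).hasFDerivAt
  have hf2 : HasFDerivAt (fderiv ℝ f) (fderiv ℝ (fderiv ℝ f) (s₀, t₀)) (s₀, t₀) :=
    ((hf.fderiv_right (m := 1) (by simp)).differentiableAt (by simp)).hasFDerivAt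
  have hsymm := hf.isSymmSndFDerivAt_of_omega
  have i₁ : HasFDerivAt (fun s : E => (s, t₀)) (ContinuousLinearMap.inl ℝ E E) s₀ :=
    (hasFDerivAt_id s₀).prodMk (hasFDerivAt_const t₀ s₀)
  have i₂ : HasFDerivAt (fun t : E => (s₀, t)) (ContinuousLinearMap.inr ℝ E E) t₀ :=
    (hasFDerivAt_const s₀ t₀).prodMk (hasFDerivAt_id t₀)
  have hW1 := (hW.hasFDerivAt.comp s₀ (hfd.comp s₀ i₁))
  have hW2 := ((hf2.comp s₀ i₁).clm_apply (hasFDerivAt_const ((0 : E), w) s₀)).congr_of_eventuallyEq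
    hWf
  have hV1 := (hV.hasFDerivAt.comp t₀ (hfd.comp t₀ i₂))
  have hV2 := ((hf2.comp t₀ i₂).clm_apply (hasFDerivAt_const (v, (0 : E)) t₀)).congr_of_eventuallyEq
    hVf
  have eW := DFunLike.congr_fun (hW1.unique hW2) v
  have eV := DFunLike.congr_fun (hV1.unique hV2) w
  rw [hVf.self_of_nhds, hWf.self_of_nhds]
  simp at eW eV
  rw [eW, eV, hsymm]

/-! ### Commutation of left- and right-invariant fields -/

section

variable {E : Type*} [NormedAddCommGroup E] [NormedSpace ℝ E]
  {G : Type*} [TopologicalSpace G] [ChartedSpace E G] [Group G] [LieGroup 𝓘(ℝ, E) ω G]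

/-- Serves both kinds of invariant field, with `h` a left or a right translation. The inverse chart
at `1` has identity derivative at its centre, so `v` needs no correction. -/
theorem chartField_eq_fderiv {V : Π a : G, TangentSpace 𝓘(ℝ, E) a} {h : G → G} (hh : MDiffAt h 1)
    {a b : G} (h1 : h 1 = b) (hb : b ∈ (chartAt E a).source) {v : E}
    (hV : fieldValue V b = (mfderiv% h 1 : E →L[ℝ] E) v) :
    chartField V a (extChartAt 𝓘(ℝ, E) a b) =
      fderiv ℝ (extChartAt 𝓘(ℝ, E) a ∘ h ∘ (extChartAt 𝓘(ℝ, E) (1 : G)).symm)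
        (extChartAt 𝓘(ℝ, E) (1 : G) 1) v := by
  subst h1
  have hb' : h 1 ∈ (extChartAt 𝓘(ℝ, E) a).source := by rwa [extChartAt_source]
  have k1 : (fieldValue V ((extChartAt 𝓘(ℝ, E) a).symm (extChartAt 𝓘(ℝ, E) a (h 1))) : E) =
    fieldValue V (h 1) := by rw [(extChartAt 𝓘(ℝ, E) a).left_inv hb']
  have k2 := ContinuousLinearMap.inverse_eq
    (mfderivWithin_extChartAt_symm_comp_mfderiv_extChartAt' (I := 𝓘(ℝ, E)) hb')
    (mfderiv_extChartAt_comp_mfderivWithin_extChartAt_symm' (I := 𝓘(ℝ, E)) hb')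
  have k3 : chartField V a (extChartAt 𝓘(ℝ, E) a (h 1)) =
      (mfderiv% (extChartAt 𝓘(ℝ, E) a) (h 1) : E →L[ℝ] E) (fieldValue (E := E) V (h 1)) :=
    (congrArg _ k1).trans (DFunLike.congr_fun k2 (V (h 1)))
  have d1 : HasMFDerivAt 𝓘(ℝ, E) 𝓘(ℝ, E) (extChartAt 𝓘(ℝ, E) (1 : G)).symm
      (extChartAt 𝓘(ℝ, E) (1 : G) 1) (ContinuousLinearMap.id ℝ E) := by
    have m := mdifferentiableWithinAt_extChartAt_symm (I := 𝓘(ℝ, E))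
      (mem_extChartAt_target (I := 𝓘(ℝ, E)) (1 : G))
    have m' := m.hasMFDerivWithinAt
    rw [mfderivWithin_range_extChartAt_symm, modelWithCornersSelf_coe, range_id] at m'
    exact hasMFDerivWithinAt_univ.1 m'
  have d2 : HasMFDerivAt 𝓘(ℝ, E) 𝓘(ℝ, E) h
      ((extChartAt 𝓘(ℝ, E) (1 : G)).symm (extChartAt 𝓘(ℝ, E) (1 : G) 1)) (mfderiv% h 1) := by
    rw [extChartAt_to_inv]
    exact hh.hasMFDerivAt
  have d3 : HasMFDerivAt 𝓘(ℝ, E) 𝓘(ℝ, E) (extChartAt 𝓘(ℝ, E) a)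
      (h ((extChartAt 𝓘(ℝ, E) (1 : G)).symm (extChartAt 𝓘(ℝ, E) (1 : G) 1)))
      (mfderiv% (extChartAt 𝓘(ℝ, E) a) (h 1)) := by
    rw [extChartAt_to_inv]
    exact (mdifferentiableAt_extChartAt hb).hasMFDerivAt
  let D₂ : E →L[ℝ] E := mfderiv% h 1
  let D₃ : E →L[ℝ] E := mfderiv% (extChartAt 𝓘(ℝ, E) a) (h 1)
  have d : HasFDerivAt (extChartAt 𝓘(ℝ, E) a ∘ h ∘ (extChartAt 𝓘(ℝ, E) (1 : G)).symm)
      (D₃.comp D₂) (extChartAt 𝓘(ℝ, E) (1 : G) 1) :=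
    (HasMFDerivAt.comp (extChartAt 𝓘(ℝ, E) (1 : G) 1)
      (f := h ∘ (extChartAt 𝓘(ℝ, E) (1 : G)).symm) d3 (HasMFDerivAt.comp _ d2 d1)).hasFDerivAt
  rw [k3, hV, d.fderiv]
  rfl

/-- Conjugating right translation by `b` with inversion gives left translation by `b⁻¹`;
differentiating this at `1` identifies the pullback with a right translate. -/
theorem fieldValue_rightInvariantField (v : GroupLieAlgebra 𝓘(ℝ, E) G) (b : G) :
    fieldValue (rightInvariantField v) b =
      (mfderiv% (fun x : G => x * b) 1 : E →L[ℝ] E) ((mfderiv% (fun x : G => x⁻¹) 1) v) := by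
  have hinv (c : G) : MDiffAt (fun x : G => x⁻¹) c :=
    (contMDiff_inv 𝓘(ℝ, E) ω).mdifferentiable (by simp) c
  have d1 := (hinv 1).hasMFDerivAt
  have d2 : HasMFDerivAt 𝓘(ℝ, E) 𝓘(ℝ, E) (fun x : G => x * b) ((1 : G)⁻¹)
      (mfderiv% (fun x : G => x * b) 1) := by
    rw [inv_one]
    exact ((contMDiff_mul_right (n := ω)).mdifferentiable (by simp) (1 : G)).hasMFDerivAt
  have d3 : HasMFDerivAt 𝓘(ℝ, E) 𝓘(ℝ, E) (fun x : G => x⁻¹) ((1 : G)⁻¹ * b)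
      (mfderiv% (fun x : G => x⁻¹) b) := by
    rw [inv_one, one_mul]
    exact (hinv b).hasMFDerivAt
  have d := HasMFDerivAt.comp (1 : G) (f := (fun x : G => x * b) ∘ (fun x : G => x⁻¹)) d3
    (HasMFDerivAt.comp (1 : G) d2 d1)
  have e : ((fun x : G => x⁻¹) ∘ (fun x : G => x * b) ∘ (fun x : G => x⁻¹)) =
      fun x : G => b⁻¹ * x := by
    ext x
    simp
  rw [e] at d
  have h := DFunLike.congr_fun d.mfderiv v
  exact ((isInvertible_mfderiv_inv b).inverse_apply_eq).2 h

theorem mlieBracket_rightInvariantField_mulInvariantVectorField [CompleteSpace E]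
    (v w : GroupLieAlgebra 𝓘(ℝ, E) G) :
    mlieBracket 𝓘(ℝ, E) (rightInvariantField v) (mulInvariantVectorField w) = 0 := by
  ext a
  set φ := extChartAt 𝓘(ℝ, E) a with hφ
  set ψ := (extChartAt 𝓘(ℝ, E) (1 : G)).symm with hψ
  set s₀ : E := extChartAt 𝓘(ℝ, E) (1 : G) 1 with hs₀
  have hψ₀ : ψ s₀ = 1 := extChartAt_to_inv (1 : G)
  -- Varying `s` multiplies on the left and varying `t` on the right. The right-invariant field is
  -- the `s`-derivative along `s = s₀`, the left-invariant one the `t`-derivative along `t = s₀`;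
  -- symmetry of the second derivative then makes them commute at `a`.
  let f : E × E → E := fun p => φ (ψ p.1 * a * ψ p.2)
  have hψc : ContMDiffAt 𝓘(ℝ, E) 𝓘(ℝ, E) ω ψ s₀ :=
    (contMDiffOn_extChartAt_symm (1 : G)).contMDiffAt
      ((isOpen_extChartAt_target (1 : G)).mem_nhds (mem_extChartAt_target (1 : G)))
  have hf : ContDiffAt ℝ ω f (s₀, s₀) := by
    rw [← contMDiffAt_iff_contDiffAt]
    have h1 : ContMDiffAt 𝓘(ℝ, E × E) 𝓘(ℝ, E) ω (fun p : E × E => ψ p.1 * a * ψ p.2)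
        (s₀, s₀) := by
      refine ContMDiffAt.mul (ContMDiffAt.mul ?_ contMDiffAt_const) ?_
      · exact ContMDiffAt.comp (s₀, s₀) (g := ψ) hψc contDiffAt_fst.contMDiffAt
      · exact ContMDiffAt.comp (s₀, s₀) (g := ψ) hψc contDiffAt_snd.contMDiffAt
    refine ContMDiffAt.comp (s₀, s₀) (g := φ) ?_ h1
    simp only [hψ₀, one_mul, mul_one]
    exact contMDiffAt_extChartAt
  have hfn : ∀ᶠ p in 𝓝 (s₀, s₀), DifferentiableAt ℝ f p :=
    (hf.eventually (by simp)).mono fun p hp => hp.differentiableAt (by simp)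
  have hcs : ContinuousAt ψ s₀ := hψc.continuousAt
  have := topologicalGroup_of_lieGroup (G := G) 𝓘(ℝ, E) ω
  have hsrc : (chartAt E a).source ∈ 𝓝 a := chart_source_mem_nhds E a
  have hr : ∀ᶠ t in 𝓝 s₀, a * ψ t ∈ (chartAt E a).source := by
    refine (continuousAt_const.mul hcs).eventually_mem ?_
    simpa [hψ₀] using hsrc
  have hl : ∀ᶠ t in 𝓝 s₀, ψ t * a ∈ (chartAt E a).source := by
    refine (hcs.mul continuousAt_const).eventually_mem ?_
    simpa [hψ₀] using hsrc
  have hf₀ : f (s₀, s₀) = φ a := by simp [f, hψ₀]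
  have hVd : MDiffAt (T% (rightInvariantField v)) a :=
    (contMDiff_rightInvariantField v).mdifferentiable (by simp) a
  have hWd : MDiffAt (T% (mulInvariantVectorField (I := 𝓘(ℝ, E)) w)) a :=
    (contMDiff_omega_mulInvariantVectorField w).mdifferentiable (by simp) a
  have key := fderiv_apply_comm_of_partials hf
    (V := chartField (rightInvariantField v) a) (W := chartField (mulInvariantVectorField w) a)
    (v := (mfderiv% (fun x : G => x⁻¹) 1) v) (w := w)
    (by rw [hf₀]; exact differentiableAt_chartField hVd)
    (by rw [hf₀]; exact differentiableAt_chartField hWd)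
    (by
      filter_upwards [hr, ((Continuous.prodMk_right s₀).tendsto s₀).eventually hfn] with t ht hft
      have h1 := chartField_eq_fderiv (V := rightInvariantField v) (h := fun x => x * (a * ψ t))
        ((contMDiff_mul_right (n := ω)).mdifferentiable (by simp) (1 : G)) (one_mul _) ht
        (fieldValue_rightInvariantField v (a * ψ t))
      have h2 : (φ ∘ (fun x => x * (a * ψ t)) ∘ ψ) = f ∘ fun s => (s, t) := by
        ext s
        simp [f, mul_assoc]
      have h3 : HasFDerivAt (fun s : E => (s, t)) (ContinuousLinearMap.inl ℝ E E) s₀ :=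
        (hasFDerivAt_id s₀).prodMk (hasFDerivAt_const t s₀)
      rw [← hφ, ← hψ, h2, (HasFDerivAt.comp s₀ hft.hasFDerivAt h3).fderiv] at h1
      refine Eq.trans ?_ h1
      simp [f, hψ₀])
    (by
      filter_upwards [hl, ((Continuous.prodMk_left s₀).tendsto s₀).eventually hfn] with s hs hfs
      have h1 := chartField_eq_fderiv (V := mulInvariantVectorField (I := 𝓘(ℝ, E)) w)
        (h := fun x => (ψ s * a) * x) (v := w)
        ((contMDiff_mul_left (n := ω)).mdifferentiable (by simp) (1 : G)) (mul_one _) hs rfl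
      have h2 : (φ ∘ (fun x => (ψ s * a) * x) ∘ ψ) = f ∘ fun t => (s, t) := by
        ext t
        simp [f]
      have h3 : HasFDerivAt (fun t : E => (s, t)) (ContinuousLinearMap.inr ℝ E E) s₀ :=
        (hasFDerivAt_const s s₀).prodMk (hasFDerivAt_id s₀)
      rw [← hφ, ← hψ, h2, (HasFDerivAt.comp s₀ hfs.hasFDerivAt h3).fderiv] at h1
      refine Eq.trans ?_ h1
      simp [f, hψ₀])
  rw [hf₀, hφ, chartField_self, chartField_self] at key
  have h := fieldValue_mlieBracket (rightInvariantField v) (mulInvariantVectorField w) a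
  exact h.trans (sub_eq_zero.2 key)

/-! ### Three-dimensional Lie algebras -/

section LieAlgebra

variable {L : Type*} [LieRing L] [LieAlgebra ℝ L]

theorem exists_coords_of_finrank_eq_three {V : Type*} [AddCommGroup V] [Module ℝ V]
    (hV : Module.finrank ℝ V = 3) {x y z : V} (h : LinearIndependent ℝ ![x, y, z]) (v : V) :
    ∃ a b c : ℝ, v = a • x + b • y + c • z := by
  let b := basisOfLinearIndependentOfCardEqFinrank h (by simp [hV])
  refine ⟨b.repr v 0, b.repr v 1, b.repr v 2, ?_⟩
  have := b.sum_repr v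
  rw [Fin.sum_univ_three] at this
  simpa [b] using this.symm

theorem linearIndependent_triple_iff {V : Type*} [AddCommGroup V] [Module ℝ V] {x y z : V} :
    LinearIndependent ℝ ![x, y, z] ↔
      ∀ a b c : ℝ, a • x + b • y + c • z = 0 → a = 0 ∧ b = 0 ∧ c = 0 := by
  rw [Fintype.linearIndependent_iff]
  constructor
  · intro h a b c habc
    have := h ![a, b, c] (by simpa [Fin.sum_univ_three] using habc)
    exact ⟨this 0, this 1, this 2⟩
  · intro h g hg
    rw [Fin.sum_univ_three] at hg
    obtain ⟨h0, h1, h2⟩ := h _ _ _ hg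
    intro i
    fin_cases i <;> assumption

/-- Bivectors in dimension three are decomposable: `a` times `a y∧z + b z∧x + c x∧y` equals `(a y -
b x) ∧ (a z - c x)`. A nonzero bivector killed by the bracket is therefore a commuting pair. -/
theorem exists_commuting_pair_of_dependent_brackets {x y z : L}
    (h : LinearIndependent ℝ ![x, y, z]) {a b c : ℝ} (ha : a ≠ 0)
    (habc : a • ⁅y, z⁆ + b • ⁅z, x⁆ + c • ⁅x, y⁆ = 0) :
    ∃ u v : L, ⁅u, v⁆ = 0 ∧ ∀ p q : ℝ, p • u + q • v = 0 → p = 0 ∧ q = 0 := by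
  refine ⟨a • y - b • x, a • z - c • x, ?_, ?_⟩
  · have : ⁅a • y - b • x, a • z - c • x⁆ = a • (a • ⁅y, z⁆ + b • ⁅z, x⁆ + c • ⁅x, y⁆) := by
      rw [← lie_skew z x, ← lie_skew x y]
      simp only [lie_sub, sub_lie, lie_smul, smul_lie, lie_self]
      module
    rw [this, habc, smul_zero]
  · intro p q hpq
    obtain ⟨-, h1, h2⟩ := linearIndependent_triple_iff.1 h (-(p * b + q * c)) (p * a) (q * a) (by
      rw [← hpq]
      module)
    exact ⟨(mul_eq_zero.1 h1).resolve_right ha, (mul_eq_zero.1 h2).resolve_right ha⟩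

/-- A three-dimensional Lie algebra generated by two elements either has a commutative
two-dimensional subalgebra or is unimodular, the latter being expressed by structure constants. -/
theorem exists_commuting_pair_or_unimodular (hL : Module.finrank ℝ L = 3) {x y : L}
    (h : LinearIndependent ℝ ![x, y, ⁅x, y⁆]) :
    (∃ u v : L, ⁅u, v⁆ = 0 ∧ ∀ p q : ℝ, p • u + q • v = 0 → p = 0 ∧ q = 0) ∨
      ∃ a b c : ℝ, ⁅y, ⁅x, y⁆⁆ = a • x + b • y ∧ ⁅⁅x, y⁆, x⁆ = b • x + c • y := by
  obtain ⟨z, hz⟩ : ∃ z, z = ⁅x, y⁆ := ⟨_, rfl⟩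
  rw [← hz] at h ⊢
  obtain ⟨a₀, a₁, a₂, ha⟩ := exists_coords_of_finrank_eq_three hL h ⁅y, z⁆
  obtain ⟨b₀, b₁, b₂, hb⟩ := exists_coords_of_finrank_eq_three hL h ⁅z, x⁆
  -- This is the Jacobi identity for `x`, `y`, `z`. A nonzero coefficient yields a commuting pair;
  -- if all vanish, the structure matrix is symmetric.
  have hj : b₂ • ⁅y, z⁆ + (-a₂) • ⁅z, x⁆ + (a₁ - b₀) • ⁅x, y⁆ = 0 := by
    have k₁ : ⁅x, ⁅y, z⁆⁆ = a₁ • ⁅x, y⁆ - a₂ • ⁅z, x⁆ := by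
      rw [ha, ← lie_skew z x]
      simp only [lie_add, lie_smul, lie_self]
      module
    have k₂ : ⁅y, ⁅z, x⁆⁆ = b₂ • ⁅y, z⁆ - b₀ • ⁅x, y⁆ := by
      rw [hb, ← lie_skew x y]
      simp only [lie_add, lie_smul, lie_self]
      module
    have hj := lie_jacobi x y z
    rw [← hz, lie_self, add_zero, k₁, k₂] at hj
    rw [← hj]
    module
  by_cases h0 : b₂ = 0
  · by_cases h1 : a₂ = 0
    · by_cases h2 : a₁ = b₀
      · right
        refine ⟨a₀, a₁, b₁, ?_, ?_⟩
        · rw [ha, h1]; module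
        · rw [hb, h0, h2]; module
      · left
        -- The basis is permuted cyclically to bring the nonzero coefficient to the front.
        refine exists_commuting_pair_of_dependent_brackets (x := z) (y := x) (z := y) 
          (a := a₁ - b₀) (b := b₂) (c := -a₂) ?_ (sub_ne_zero.2 h2) (by rw [← hj]; abel)
        rw [linearIndependent_triple_iff] at h ⊢
        intro a b c habc
        obtain ⟨h1, h2, h3⟩ := h b c a (by rw [← habc]; abel)
        exact ⟨h3, h1, h2⟩
    · left
      refine exists_commuting_pair_of_dependent_brackets (x := y) (y := z) (z := x) 
          (a := -a₂) (b := a₁ - b₀) (c := b₂) ?_ (neg_ne_zero.2 h1) (by rw [← hj]; abel)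
      rw [linearIndependent_triple_iff] at h ⊢
      intro a b c habc
      obtain ⟨h1, h2, h3⟩ := h c a b (by rw [← habc]; abel)
      exact ⟨h2, h3, h1⟩
  · exact Or.inl (exists_commuting_pair_of_dependent_brackets h h0 hj)

end LieAlgebra

/-! ### Poisson brackets through differentials -/

section Poisson

variable {E : Type*} [NormedAddCommGroup E] [NormedSpace ℝ E]

/-- The canonical Poisson structure on covectors of `E × E*`. -/
def canonicalPoisson :
    ((E × (E →L[ℝ] ℝ)) →L[ℝ] ℝ) →ₗ[ℝ] ((E × (E →L[ℝ] ℝ)) →L[ℝ] ℝ) →ₗ[ℝ] ℝ :=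
  LinearMap.mk₂ ℝ (fun α β => β (0, α.comp (ContinuousLinearMap.inl ℝ E (E →L[ℝ] ℝ))) -
      α (0, β.comp (ContinuousLinearMap.inl ℝ E (E →L[ℝ] ℝ))))
    (fun α α' β => by
      have : ((0 : E), (α + α').comp (ContinuousLinearMap.inl ℝ E (E →L[ℝ] ℝ))) =
        (0, α.comp (ContinuousLinearMap.inl ℝ E (E →L[ℝ] ℝ))) +
          (0, α'.comp (ContinuousLinearMap.inl ℝ E (E →L[ℝ] ℝ))) := by simp
      rw [this, map_add, add_apply]
      ring)
    (fun c α β => by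
      have : ((0 : E), (c • α).comp (ContinuousLinearMap.inl ℝ E (E →L[ℝ] ℝ))) =
        c • (0, α.comp (ContinuousLinearMap.inl ℝ E (E →L[ℝ] ℝ))) := by simp
      rw [this, map_smul, smul_apply, smul_sub])
    (fun α β β' => by
      have : ((0 : E), (β + β').comp (ContinuousLinearMap.inl ℝ E (E →L[ℝ] ℝ))) =
        (0, β.comp (ContinuousLinearMap.inl ℝ E (E →L[ℝ] ℝ))) +
          (0, β'.comp (ContinuousLinearMap.inl ℝ E (E →L[ℝ] ℝ))) := by simp
      rw [this, map_add, add_apply]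
      ring)
    (fun c α β => by
      have : ((0 : E), (c • β).comp (ContinuousLinearMap.inl ℝ E (E →L[ℝ] ℝ))) =
        c • (0, β.comp (ContinuousLinearMap.inl ℝ E (E →L[ℝ] ℝ))) := by simp
      rw [this, map_smul, smul_apply, smul_sub])

theorem canonicalPoisson_swap (α β : (E × (E →L[ℝ] ℝ)) →L[ℝ] ℝ) :
    canonicalPoisson α β = -canonicalPoisson β α := by
  simp [canonicalPoisson]

theorem canonicalPoisson_self (α : (E × (E →L[ℝ] ℝ)) →L[ℝ] ℝ) : canonicalPoisson α α = 0 := by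
  simp [canonicalPoisson]

variable {M : Type*} [TopologicalSpace M] [ChartedSpace E M] [IsManifold 𝓘(ℝ, E) ω M]

/-- The bracket depends only on the two differentials, bilinearly; with the differential of a
quadratic polynomial this takes the place of the Leibniz rule. -/
theorem poissonBracket_eq_canonicalPoisson (F K : CotangentBundle E M → ℝ)
    (z : CotangentBundle E M) : poissonBracket F K z =
      canonicalPoisson (cotangentDifferential F z) (cotangentDifferential K z) := rfl

/-- A quadratic form in three functions, without the mixed terms of the third one. -/
def quadraticIn (c₀ c₁ c₂ c₃ : ℝ) (F₀ F₁ F₂ : CotangentBundle E M → ℝ)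
    (z : CotangentBundle E M) : ℝ :=
  c₀ * F₀ z ^ 2 + c₁ * (F₀ z * F₁ z) + c₂ * F₁ z ^ 2 + c₃ * F₂ z ^ 2

variable {F₀ F₁ F₂ : CotangentBundle E M → ℝ}

theorem contMDiff_quadraticIn (h₀ : ContMDiff (cotangentModel E) 𝓘(ℝ) ω F₀)
    (h₁ : ContMDiff (cotangentModel E) 𝓘(ℝ) ω F₁) (h₂ : ContMDiff (cotangentModel E) 𝓘(ℝ) ω F₂)
    (c₀ c₁ c₂ c₃ : ℝ) :
    ContMDiff (cotangentModel E) 𝓘(ℝ) ω (quadraticIn c₀ c₁ c₂ c₃ F₀ F₁ F₂) := by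
  have hQ : ContDiff ℝ ω (fun x : ℝ × ℝ × ℝ =>
      c₀ * x.1 ^ 2 + c₁ * (x.1 * x.2.1) + c₂ * x.2.1 ^ 2 + c₃ * x.2.2 ^ 2) := by fun_prop
  exact hQ.contMDiff.comp (h₀.prodMk_space (h₁.prodMk_space h₂))

theorem cotangentDifferential_quadraticIn {z : CotangentBundle E M}
    (h₀ : MDifferentiableAt (cotangentModel E) 𝓘(ℝ) F₀ z)
    (h₁ : MDifferentiableAt (cotangentModel E) 𝓘(ℝ) F₁ z)
    (h₂ : MDifferentiableAt (cotangentModel E) 𝓘(ℝ) F₂ z) (c₀ c₁ c₂ c₃ : ℝ) :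
    cotangentDifferential (quadraticIn c₀ c₁ c₂ c₃ F₀ F₁ F₂) z =
      (2 * c₀ * F₀ z + c₁ * F₁ z) • cotangentDifferential F₀ z +
        (c₁ * F₀ z + 2 * c₂ * F₁ z) • cotangentDifferential F₁ z +
          (2 * c₃ * F₂ z) • cotangentDifferential F₂ z := by
  let π₀ : ℝ × ℝ × ℝ →L[ℝ] ℝ := ContinuousLinearMap.fst ℝ ℝ (ℝ × ℝ)
  let π₁ : ℝ × ℝ × ℝ →L[ℝ] ℝ :=
    (ContinuousLinearMap.fst ℝ ℝ ℝ).comp (ContinuousLinearMap.snd ℝ ℝ (ℝ × ℝ))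
  let π₂ : ℝ × ℝ × ℝ →L[ℝ] ℝ :=
    (ContinuousLinearMap.snd ℝ ℝ ℝ).comp (ContinuousLinearMap.snd ℝ ℝ (ℝ × ℝ))
  have hQ : HasFDerivAt (fun x : ℝ × ℝ × ℝ =>
      c₀ * x.1 ^ 2 + c₁ * (x.1 * x.2.1) + c₂ * x.2.1 ^ 2 + c₃ * x.2.2 ^ 2)
      ((2 * c₀ * F₀ z + c₁ * F₁ z) • π₀ + (c₁ * F₀ z + 2 * c₂ * F₁ z) • π₁ +
        (2 * c₃ * F₂ z) • π₂) (F₀ z, F₁ z, F₂ z) := by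
    have d₀ := π₀.hasFDerivAt (x := (F₀ z, F₁ z, F₂ z))
    have d₁ := π₁.hasFDerivAt (x := (F₀ z, F₁ z, F₂ z))
    have d₂ := π₂.hasFDerivAt (x := (F₀ z, F₁ z, F₂ z))
    refine HasFDerivAt.congr_fderiv (((((d₀.pow 2).const_mul c₀).add
      ((d₀.mul d₁).const_mul c₁)).add ((d₁.pow 2).const_mul c₂)).add ((d₂.pow 2).const_mul c₃)) ?_
    refine ContinuousLinearMap.ext fun x => ?_
    simp [π₀, π₁, π₂]
    ring
  have h : HasMFDerivAt (cotangentModel E) 𝓘(ℝ, ℝ × ℝ × ℝ) (fun z => (F₀ z, F₁ z, F₂ z)) z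
      ((cotangentDifferential F₀ z).prod
        ((cotangentDifferential F₁ z).prod (cotangentDifferential F₂ z))) :=
    ⟨h₀.continuousAt.prodMk (h₁.continuousAt.prodMk h₂.continuousAt),
      h₀.hasMFDerivAt.2.prodMk (h₁.hasMFDerivAt.2.prodMk h₂.hasMFDerivAt.2)⟩
  exact (HasMFDerivAt.comp z hQ.hasMFDerivAt h).mfderiv

theorem isAnalyticallyIntegrable_of_three [FiniteDimensional ℝ E] [MeasurableSpace E]
    [BorelSpace E] (hE : Module.finrank ℝ E = 3)
    (h₀ : ContMDiff (cotangentModel E) 𝓘(ℝ) ω F₀)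
    (h₁ : ContMDiff (cotangentModel E) 𝓘(ℝ) ω F₁) (h₂ : ContMDiff (cotangentModel E) 𝓘(ℝ) ω F₂)
    (h₀₁ : ∀ z, poissonBracket F₀ F₁ z = 0) (h₀₂ : ∀ z, poissonBracket F₀ F₂ z = 0)
    (h₁₂ : ∀ z, poissonBracket F₁ F₂ z = 0)
    {S : Set (CotangentBundle E M)} (hS : IsNullSet S)
    (hind : ∀ z ∉ S, LinearIndependent ℝ ![cotangentDifferential F₀ z,
      cotangentDifferential F₁ z, cotangentDifferential F₂ z]) :
    IsAnalyticallyIntegrable F₀ := by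
  have hswap {F K : CotangentBundle E M → ℝ} {z} (h : poissonBracket F K z = 0) :
      poissonBracket K F z = 0 := by
    rw [poissonBracket_eq_canonicalPoisson, canonicalPoisson_swap,
      ← poissonBracket_eq_canonicalPoisson, h, neg_zero]
  have hself (F : CotangentBundle E M → ℝ) (z) : poissonBracket F F z = 0 := canonicalPoisson_self _
  -- Only the indices below three matter; the larger ones repeat `F₂`.
  refine ⟨fun i => if i = 0 then F₀ else if i = 1 then F₁ else F₂, rfl, ?_, ?_, hS.mono ?_⟩
  · rw [hE]
    intro i hi
    interval_cases i <;> simpa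
  · rw [hE]
    intro i hi j hj z
    interval_cases i <;> interval_cases j <;> simp [hself, h₀₁, h₀₂, h₁₂, hswap]
  · intro z hz
    by_contra hzS
    refine hz ?_
    rw [← linearIndependent_equiv (finCongr hE.symm)]
    convert hind z hzS using 1
    ext i : 1
    fin_cases i <;> rfl

end Poisson

/-! ### Brackets and independence of invariant momenta -/

section InvariantMomenta

variable {E : Type*} [NormedAddCommGroup E] [NormedSpace ℝ E]
  {G : Type*} [TopologicalSpace G] [ChartedSpace E G] [Group G]

/-- The momentum of a left-invariant vector field. -/
def leftMomentum (v : GroupLieAlgebra 𝓘(ℝ, E) G) : CotangentBundle E G → ℝ :=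
  momentum (mulInvariantVectorField v)

/-- The momentum of a right-invariant vector field. -/
def rightMomentum (v : GroupLieAlgebra 𝓘(ℝ, E) G) : CotangentBundle E G → ℝ :=
  momentum (rightInvariantField v)

theorem leftMomentum_add (v w : GroupLieAlgebra 𝓘(ℝ, E) G) (z : CotangentBundle E G) :
    leftMomentum (v + w) z = leftMomentum v z + leftMomentum w z := by
  rw [leftMomentum, mulInvariantVectorField_add]
  exact map_add z.2 _ _

theorem leftMomentum_smul (c : ℝ) (v : GroupLieAlgebra 𝓘(ℝ, E) G) (z : CotangentBundle E G) :
    leftMomentum (c • v) z = c * leftMomentum v z := by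
  rw [leftMomentum, mulInvariantVectorField_smul]
  exact map_smul z.2 _ _

theorem rightMomentum_zero (z : CotangentBundle E G) :
    rightMomentum (0 : GroupLieAlgebra 𝓘(ℝ, E) G) z = 0 := by
  rw [rightMomentum, ← zero_smul ℝ (0 : GroupLieAlgebra 𝓘(ℝ, E) G), rightInvariantField_smul,
    zero_smul]
  exact map_zero z.2

variable [LieGroup 𝓘(ℝ, E) ω G]

theorem contMDiff_leftMomentum (v : GroupLieAlgebra 𝓘(ℝ, E) G) :
    ContMDiff (cotangentModel E) 𝓘(ℝ) ω (leftMomentum v) :=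
  contMDiff_momentum (contMDiff_omega_mulInvariantVectorField v)

theorem mdifferentiable_mulInvariantVectorField_omega (v : GroupLieAlgebra 𝓘(ℝ, E) G) (a : G) :
    MDiffAt (T% (mulInvariantVectorField (I := 𝓘(ℝ, E)) v)) a :=
  (contMDiff_omega_mulInvariantVectorField v).mdifferentiable (by simp) a

variable [CompleteSpace E]

theorem contMDiff_rightMomentum (v : GroupLieAlgebra 𝓘(ℝ, E) G) :
    ContMDiff (cotangentModel E) 𝓘(ℝ) ω (rightMomentum v) :=
  contMDiff_momentum (contMDiff_rightInvariantField v)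

theorem mdifferentiable_rightInvariantField (v : GroupLieAlgebra 𝓘(ℝ, E) G) (a : G) :
    MDiffAt (T% (rightInvariantField v)) a :=
  (contMDiff_rightInvariantField v).mdifferentiable (by simp) a

variable (z : CotangentBundle E G)

theorem canonicalPoisson_left_left (v w : GroupLieAlgebra 𝓘(ℝ, E) G) :
    canonicalPoisson (cotangentDifferential (leftMomentum v) z)
      (cotangentDifferential (leftMomentum w) z) = -leftMomentum ⁅v, w⁆ z := by
  rw [← poissonBracket_eq_canonicalPoisson, leftMomentum, leftMomentum,
    poissonBracket_momentum (mdifferentiable_mulInvariantVectorField_omega v _)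
      (mdifferentiable_mulInvariantVectorField_omega w _), mlieBracket_mulInvariantVectorField]
  rfl

theorem canonicalPoisson_right_right (v w : GroupLieAlgebra 𝓘(ℝ, E) G) :
    canonicalPoisson (cotangentDifferential (rightMomentum v) z)
      (cotangentDifferential (rightMomentum w) z) = -rightMomentum ⁅v, w⁆ z := by
  rw [← poissonBracket_eq_canonicalPoisson, rightMomentum, rightMomentum,
    poissonBracket_momentum (mdifferentiable_rightInvariantField v _)
      (mdifferentiable_rightInvariantField w _), mlieBracket_rightInvariantField]
  rfl

theorem canonicalPoisson_right_left (v w : GroupLieAlgebra 𝓘(ℝ, E) G) :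
    canonicalPoisson (cotangentDifferential (rightMomentum v) z)
      (cotangentDifferential (leftMomentum w) z) = 0 := by
  rw [← poissonBracket_eq_canonicalPoisson, rightMomentum, leftMomentum,
    poissonBracket_momentum (mdifferentiable_rightInvariantField v _)
      (mdifferentiable_mulInvariantVectorField_omega w _),
    mlieBracket_rightInvariantField_mulInvariantVectorField, neg_eq_zero]
  exact map_zero z.2

theorem canonicalPoisson_left_right (v w : GroupLieAlgebra 𝓘(ℝ, E) G) :
    canonicalPoisson (cotangentDifferential (leftMomentum v) z)
      (cotangentDifferential (rightMomentum w) z) = 0 := by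
  rw [canonicalPoisson_swap, canonicalPoisson_right_left, neg_zero]

/-- On fibre directions `(0, η)` the differential of a momentum is evaluation at the field. A
relation between differentials thus becomes the vanishing of one invariant field at a point, which
forces its generator to be zero. -/
theorem eq_zero_of_left_differentials {a b c : ℝ} {x y t : GroupLieAlgebra 𝓘(ℝ, E) G}
    (h : a • cotangentDifferential (leftMomentum x) z +
      b • cotangentDifferential (leftMomentum y) z +
      c • cotangentDifferential (leftMomentum t) z = 0) : a • x + b • y + c • t = 0 := by
  by_contra hne
  refine mulInvariantVectorField_ne_zero hne z.1 ?_
  have hv : fieldValue (mulInvariantVectorField (I := 𝓘(ℝ, E)) (a • x + b • y + c • t)) z.1 =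
      a • fieldValue (mulInvariantVectorField (I := 𝓘(ℝ, E)) x) z.1 +
      b • fieldValue (mulInvariantVectorField (I := 𝓘(ℝ, E)) y) z.1 +
      c • fieldValue (mulInvariantVectorField (I := 𝓘(ℝ, E)) t) z.1 := by
    simp only [mulInvariantVectorField_add, mulInvariantVectorField_smul]
    rfl
  have key : fieldValue (mulInvariantVectorField (I := 𝓘(ℝ, E)) (a • x + b • y + c • t)) z.1 =
      0 := by
    refine SeparatingDual.eq_zero_of_forall_dual_eq_zero (R := ℝ) fun η => ?_
    have hd (v : GroupLieAlgebra 𝓘(ℝ, E) G) := partialP_momentum (z := z)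
      (mdifferentiable_mulInvariantVectorField_omega v _) η
    have h0 := DFunLike.congr_fun h ((0 : E), η)
    rw [hv, map_add, map_add, map_smul, map_smul, map_smul, ← hd, ← hd, ← hd]
    exact h0
  exact key

theorem eq_zero_of_right_differentials {a b : ℝ} {x y : GroupLieAlgebra 𝓘(ℝ, E) G}
    (h : a • cotangentDifferential (rightMomentum x) z +
      b • cotangentDifferential (rightMomentum y) z = 0) : a • x + b • y = 0 := by
  by_contra hne
  refine rightInvariantField_ne_zero hne z.1 ?_
  have hv : fieldValue (rightInvariantField (a • x + b • y)) z.1 =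
      a • fieldValue (rightInvariantField x) z.1 + b • fieldValue (rightInvariantField y) z.1 := by
    simp only [rightInvariantField_add, rightInvariantField_smul]
    rfl
  have key : fieldValue (rightInvariantField (a • x + b • y)) z.1 = 0 := by
    refine SeparatingDual.eq_zero_of_forall_dual_eq_zero (R := ℝ) fun η => ?_
    have hd (v : GroupLieAlgebra 𝓘(ℝ, E) G) := partialP_momentum (z := z)
      (mdifferentiable_rightInvariantField v _) η
    have h0 := DFunLike.congr_fun h ((0 : E), η)
    rw [hv, map_add, map_smul, map_smul, ← hd, ← hd]
    exact h0
  exact key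

end InvariantMomenta

/-! ### Integrability in the two algebraic cases -/

section ContactFrame

variable {E : Type*} [NormedAddCommGroup E] [NormedSpace ℝ E]
  {G : Type*} [TopologicalSpace G] [ChartedSpace E G] [Group G] [LieGroup 𝓘(ℝ, E) ω G]

theorem cotangentDifferential_quadraticIn_left (x y t : GroupLieAlgebra 𝓘(ℝ, E) G)
    (z : CotangentBundle E G) (c₀ c₁ c₂ c₃ : ℝ) :
    cotangentDifferential
        (quadraticIn c₀ c₁ c₂ c₃ (leftMomentum x) (leftMomentum y) (leftMomentum t)) z =
      (2 * c₀ * leftMomentum x z + c₁ * leftMomentum y z) •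
          cotangentDifferential (leftMomentum x) z +
        (c₁ * leftMomentum x z + 2 * c₂ * leftMomentum y z) •
          cotangentDifferential (leftMomentum y) z +
        (2 * c₃ * leftMomentum t z) • cotangentDifferential (leftMomentum t) z :=
  have h (v : GroupLieAlgebra 𝓘(ℝ, E) G) :=
    (contMDiff_leftMomentum v).mdifferentiable (by simp) z
  cotangentDifferential_quadraticIn (h x) (h y) (h t) c₀ c₁ c₂ c₃

theorem poissonBracket_quadraticIn_left_right [CompleteSpace E]
    (x y t v : GroupLieAlgebra 𝓘(ℝ, E) G)
    (z : CotangentBundle E G) (c₀ c₁ c₂ c₃ : ℝ) :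
    poissonBracket (quadraticIn c₀ c₁ c₂ c₃ (leftMomentum x) (leftMomentum y) (leftMomentum t))
      (rightMomentum v) z = 0 := by
  rw [poissonBracket_eq_canonicalPoisson, cotangentDifferential_quadraticIn_left]
  simp [canonicalPoisson_left_right]

variable [FiniteDimensional ℝ E] [MeasurableSpace E] [BorelSpace E]

theorem isNullSet_leftMomentum_eq_zero {v : GroupLieAlgebra 𝓘(ℝ, E) G} (hv : v ≠ 0) :
    IsNullSet {z : CotangentBundle E G | leftMomentum v z = 0} :=
  isNullSet_momentum_eq_zero (contMDiff_omega_mulInvariantVectorField v)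
    (mulInvariantVectorField_ne_zero hv)

theorem isNullSet_rightMomentum_eq_zero [CompleteSpace E] {v : GroupLieAlgebra 𝓘(ℝ, E) G}
    (hv : v ≠ 0) : IsNullSet {z : CotangentBundle E G | rightMomentum v z = 0} :=
  isNullSet_momentum_eq_zero (contMDiff_rightInvariantField v) (rightInvariantField_ne_zero hv)

variable [CompleteSpace E]

/-- If the Lie algebra has a commutative two-dimensional subalgebra, then the momenta of the
corresponding right-invariant fields complete the Hamiltonian. -/
theorem isAnalyticallyIntegrable_of_commuting_pair (hE : Module.finrank ℝ E = 3)
    {x y u v : GroupLieAlgebra 𝓘(ℝ, E) G} (hli : LinearIndependent ℝ ![x, y, ⁅x, y⁆])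
    (huv : ⁅u, v⁆ = 0) (hind : ∀ p q : ℝ, p • u + q • v = 0 → p = 0 ∧ q = 0) :
    IsAnalyticallyIntegrable
      (quadraticIn (1 / 2) 0 (1 / 2) 0 (leftMomentum x) (leftMomentum y)
        (leftMomentum ⁅x, y⁆)) := by
  refine isAnalyticallyIntegrable_of_three hE
    (contMDiff_quadraticIn (contMDiff_leftMomentum _) (contMDiff_leftMomentum _)
      (contMDiff_leftMomentum _) _ _ _ _)
    (contMDiff_rightMomentum u) (contMDiff_rightMomentum v)
    (fun z => poissonBracket_quadraticIn_left_right ..)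
    (fun z => poissonBracket_quadraticIn_left_right ..) (fun z => ?_)
    ((isNullSet_leftMomentum_eq_zero (v := y) (hli.ne_zero 1)).union
      (isNullSet_leftMomentum_eq_zero (v := ⁅x, y⁆) (hli.ne_zero 2))) (fun z hz => ?_)
  · rw [poissonBracket_eq_canonicalPoisson, canonicalPoisson_right_right, huv, rightMomentum_zero,
      neg_zero]
  · rw [mem_union, not_or] at hz
    refine (linearIndependent_triple_iff (V := (E × (E →L[ℝ] ℝ)) →L[ℝ] ℝ)).2 fun a b c habc => ?_
    -- Pairing with the left momentum of `x` kills the right momenta and leaves `-a` times the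
    -- product of the left momenta of `y` and `⁅x, y⁆`.
    have h1 := congrArg (canonicalPoisson (cotangentDifferential (leftMomentum x) z)) habc
    rw [cotangentDifferential_quadraticIn_left] at h1
    simp only [map_add, map_smul, canonicalPoisson_left_right, canonicalPoisson_self,
      canonicalPoisson_left_left, map_zero, smul_eq_mul] at h1
    have h2 : a * (leftMomentum y z * leftMomentum ⁅x, y⁆ z) = 0 := by linarith
    have ha : a = 0 := (mul_eq_zero.1 h2).resolve_right (mul_ne_zero hz.1 hz.2)
    rw [ha, zero_smul, zero_add] at habc
    exact ⟨ha, hind _ _ (eq_zero_of_right_differentials z habc)⟩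

set_option synthInstance.maxHeartbeats 400000 in
/-- In the unimodular case the Hamiltonian is completed by the quadratic Casimir function and the
momentum of a right-invariant field. -/
theorem isAnalyticallyIntegrable_of_unimodular (hE : Module.finrank ℝ E = 3)
    {x y : GroupLieAlgebra 𝓘(ℝ, E) G} (hli : LinearIndependent ℝ ![x, y, ⁅x, y⁆]) {p q r : ℝ}
    (h₀ : ⁅y, ⁅x, y⁆⁆ = p • x + q • y) (h₁ : ⁅⁅x, y⁆, x⁆ = q • x + r • y) :
    IsAnalyticallyIntegrable
      (quadraticIn (1 / 2) 0 (1 / 2) 0 (leftMomentum x) (leftMomentum y)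
        (leftMomentum ⁅x, y⁆)) := by
  have hsmooth (c₀ c₁ c₂ c₃ : ℝ) := contMDiff_quadraticIn (contMDiff_leftMomentum x)
    (contMDiff_leftMomentum y) (contMDiff_leftMomentum ⁅x, y⁆) c₀ c₁ c₂ c₃
  -- The coefficients `p`, `2 * q`, `r`, `1` are those of the quadratic form of the structure
  -- matrix. The bracket of two left momenta is, up to the factor `-1/2`, a partial derivative of
  -- this form, as for a cross product with its gradient; so the form is a Casimir.
  refine isAnalyticallyIntegrable_of_three hE (hsmooth _ _ _ _) (hsmooth p (2 * q) r 1)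
    (contMDiff_rightMomentum x) (fun z => ?_)
    (fun z => poissonBracket_quadraticIn_left_right ..)
    (fun z => poissonBracket_quadraticIn_left_right ..)
    (((isNullSet_leftMomentum_eq_zero (v := x) (hli.ne_zero 0)).union
      (isNullSet_leftMomentum_eq_zero (v := ⁅x, y⁆) (hli.ne_zero 2))).union
      (isNullSet_rightMomentum_eq_zero (v := ⁅x, y⁆) (hli.ne_zero 2))) (fun z hz => ?_)
  · have b₁₂ := canonicalPoisson_left_left z y ⁅x, y⁆
    have b₂₀ := canonicalPoisson_left_left z ⁅x, y⁆ x
    have b₀₁ := canonicalPoisson_left_left z x y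
    have b₂₁ := canonicalPoisson_swap (cotangentDifferential (leftMomentum ⁅x, y⁆) z)
      (cotangentDifferential (leftMomentum y) z)
    have b₀₂ := canonicalPoisson_swap (cotangentDifferential (leftMomentum x) z)
      (cotangentDifferential (leftMomentum ⁅x, y⁆) z)
    have b₁₀ := canonicalPoisson_swap (cotangentDifferential (leftMomentum y) z)
      (cotangentDifferential (leftMomentum x) z)
    rw [h₀, leftMomentum_add, leftMomentum_smul, leftMomentum_smul] at b₁₂
    rw [h₁, leftMomentum_add, leftMomentum_smul, leftMomentum_smul] at b₂₀
    rw [poissonBracket_eq_canonicalPoisson, cotangentDifferential_quadraticIn_left,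
      cotangentDifferential_quadraticIn_left]
    simp only [map_add, map_smul, LinearMap.add_apply, LinearMap.smul_apply, canonicalPoisson_self,
      smul_eq_mul, b₂₁, b₀₂, b₁₀, b₁₂, b₂₀, b₀₁]
    ring
  · rw [mem_union, mem_union, not_or, not_or] at hz
    obtain ⟨⟨hz₀, hz₂⟩, hzr⟩ := hz
    refine (linearIndependent_triple_iff (V := (E × (E →L[ℝ] ℝ)) →L[ℝ] ℝ)).2 fun a b c habc => ?_
    -- The right momentum of `y` commutes with `H` and with the Casimir, but its bracket with that
    -- of `x` is the right momentum of `⁅x, y⁆` up to sign.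
    have h1 := congrArg (fun α => canonicalPoisson α (cotangentDifferential (rightMomentum y) z))
      habc
    simp only [map_add, map_smul, LinearMap.add_apply, LinearMap.smul_apply, map_zero,
      LinearMap.zero_apply, smul_eq_mul, ← poissonBracket_eq_canonicalPoisson,
      poissonBracket_quadraticIn_left_right] at h1
    rw [poissonBracket_eq_canonicalPoisson, canonicalPoisson_right_right] at h1
    have hc : c = 0 := by
      have h2 : c * rightMomentum ⁅x, y⁆ z = 0 := by linarith
      exact (mul_eq_zero.1 h2).resolve_right hzr
    rw [hc, zero_smul, add_zero, cotangentDifferential_quadraticIn_left,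
      cotangentDifferential_quadraticIn_left] at habc
    -- `H` does not involve the momentum of `⁅x, y⁆`, so the third coefficient isolates `b`; the
    -- first one then gives `a`.
    have h2 := eq_zero_of_left_differentials z
      (a := a * leftMomentum x z + b * (2 * p * leftMomentum x z + 2 * q * leftMomentum y z))
      (b := a * leftMomentum y z + b * (2 * q * leftMomentum x z + 2 * r * leftMomentum y z))
      (c := b * (2 * leftMomentum ⁅x, y⁆ z)) (x := x) (y := y) (t := ⁅x, y⁆) (by
        rw [← habc]
        module)
    obtain ⟨k₀, -, k₂⟩ := linearIndependent_triple_iff.1 hli _ _ _ h2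
    have hb : b = 0 :=
      (mul_eq_zero.1 k₂).resolve_right (mul_ne_zero two_ne_zero hz₂)
    rw [hb, zero_mul, add_zero] at k₀
    exact ⟨(mul_eq_zero.1 k₀).resolve_right hz₀, hb, hc⟩

end ContactFrame

/-! ### Orthonormal frames and the contact condition -/

namespace LeftInvariantSubRiemannian

variable {E : Type*} [NormedAddCommGroup E] [NormedSpace ℝ E]
  {G : Type*} [TopologicalSpace G] [ChartedSpace E G] [Group G]

theorem metric_sharp_apply (S : LeftInvariantSubRiemannian E G) [FiniteDimensional ℝ S.plane]
    (ρ : Module.Dual ℝ S.plane) (v : S.plane) : S.metric (S.sharp ρ) v = ρ v :=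
  LinearMap.BilinForm.apply_toDual_symm_apply ..

/-- An orthogonal basis is divided by its norms; in an orthonormal basis the components of `♯ρ` are
the values of `ρ`. -/
theorem exists_orthonormal_frame (S : LeftInvariantSubRiemannian E G)
    [FiniteDimensional ℝ S.plane] (hS : Module.finrank ℝ S.plane = 2) :
    ∃ b : Module.Basis (Fin 2) ℝ S.plane, ∀ ρ : Module.Dual ℝ S.plane,
      S.metric (S.sharp ρ) (S.sharp ρ) = ρ (b 0) ^ 2 + ρ (b 1) ^ 2 := by
  obtain ⟨v', hv'⟩ := LinearMap.BilinForm.exists_orthogonal_basis (B := S.metric)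
    ⟨fun v w => S.metric_symm v w⟩
  let v := v'.reindex (finCongr hS)
  have hv : ∀ i j, i ≠ j → S.metric (v i) (v j) = 0 := fun i j hij => by
    simpa [v] using hv' (i := (finCongr hS).symm i) (j := (finCongr hS).symm j) (by simpa using hij)
  have hpos (i : Fin 2) : 0 < S.metric (v i) (v i) := S.metric_pos _ (v.ne_zero i)
  have hne (i : Fin 2) : (Real.sqrt (S.metric (v i) (v i)))⁻¹ ≠ 0 :=
    inv_ne_zero (Real.sqrt_pos.2 (hpos i)).ne'
  refine ⟨v.unitsSMul fun i => Units.mk0 _ (hne i), fun ρ => ?_⟩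
  have hsum := v.sum_repr (S.sharp ρ)
  rw [Fin.sum_univ_two] at hsum
  have h0 : ρ (v 0) = v.repr (S.sharp ρ) 0 * S.metric (v 0) (v 0) := by
    rw [← metric_sharp_apply, ← hsum]
    simp [hv 1 0 (by simp)]
  have h1 : ρ (v 1) = v.repr (S.sharp ρ) 1 * S.metric (v 1) (v 1) := by
    rw [← metric_sharp_apply, ← hsum]
    simp [hv 0 1 (by simp)]
  have hs (i : Fin 2) (x : ℝ) : ((Real.sqrt (S.metric (v i) (v i)))⁻¹ * x) ^ 2 =
      x ^ 2 / S.metric (v i) (v i) := by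
    rw [mul_pow, inv_pow, Real.sq_sqrt (hpos i).le, div_eq_inv_mul]
  rw [metric_sharp_apply]
  nth_rw 1 [← hsum]
  simp only [Module.Basis.unitsSMul_apply, Units.smul_def, Units.val_mk0, map_add, map_smul,
    smul_eq_mul, hs]
  have n0 := (hpos 0).ne'
  have n1 := (hpos 1).ne'
  rw [h0, h1]
  field_simp

theorem linearIndependent_frame_append (S : LeftInvariantSubRiemannian E G)
    (b : Module.Basis (Fin 2) ℝ S.plane) {f : GroupLieAlgebra 𝓘(ℝ, E) G} (hf : f ∉ S.plane) :
    LinearIndependent ℝ ![(b 0 : GroupLieAlgebra 𝓘(ℝ, E) G), b 1, f] := by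
  rw [linearIndependent_triple_iff]
  intro p q r h
  have hr : r = 0 := by
    by_contra hr
    refine hf ?_
    have : f = (((-r⁻¹ * p) • b 0 + (-r⁻¹ * q) • b 1 : S.plane) : GroupLieAlgebra 𝓘(ℝ, E) G) := by
      have h2 : f = r⁻¹ • (p • (b 0 : GroupLieAlgebra 𝓘(ℝ, E) G) + q • b 1 + r • f) +
          (((-r⁻¹ * p) • b 0 + (-r⁻¹ * q) • b 1 : S.plane) : GroupLieAlgebra 𝓘(ℝ, E) G) := by
        simp only [Submodule.coe_add, Submodule.coe_smul, smul_add, smul_smul, inv_mul_cancel₀ hr]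
        module
      rwa [h, smul_zero, zero_add] at h2
    rw [this]
    exact Subtype.property _
  rw [hr, zero_smul, add_zero] at h
  have h2 : p • b 0 + q • b 1 = 0 := Subtype.ext h
  have h3 := Fintype.linearIndependent_iff.1 b.linearIndependent ![p, q]
    (by simpa [Fin.sum_univ_two] using h2)
  exact ⟨h3 0, h3 1, hr⟩

variable [FiniteDimensional ℝ E]

/-- `K` enters with coefficient zero and is free. Choosing the left momentum of `⁅b 0, b 1⁆` gives
`H` the same shape as the Casimir. -/
theorem hamiltonian_eq_quadraticIn (S : LeftInvariantSubRiemannian E G)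
    [FiniteDimensional ℝ S.plane] {b : Module.Basis (Fin 2) ℝ S.plane}
    (hb : ∀ ρ : Module.Dual ℝ S.plane,
      S.metric (S.sharp ρ) (S.sharp ρ) = ρ (b 0) ^ 2 + ρ (b 1) ^ 2)
    (K : CotangentBundle E G → ℝ) :
    S.hamiltonian = quadraticIn (1 / 2) 0 (1 / 2) 0
      (leftMomentum (b 0 : GroupLieAlgebra 𝓘(ℝ, E) G))
      (leftMomentum (b 1 : GroupLieAlgebra 𝓘(ℝ, E) G)) K := by
  funext z
  have h : S.hamiltonian z = 1 / 2 *
      (leftMomentum (b 0 : GroupLieAlgebra 𝓘(ℝ, E) G) z ^ 2 +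
        leftMomentum (b 1 : GroupLieAlgebra 𝓘(ℝ, E) G) z ^ 2) :=
    congrArg (1 / 2 * ·) (hb (S.restrict z))
  rw [h, quadraticIn]
  ring

variable [CompleteSpace E] [LieGroup 𝓘(ℝ, E) ω G]

/-- In dimension three `α ∧ dα` is determined by its value on `b 0`, `b 1` and a transversal `f`,
which is `-α f * α ⁅b 0, b 1⁆` when `α` annihilates the plane. A bracket inside the plane would make
it vanish. -/
theorem lie_notMem_plane (hE : Module.finrank ℝ E = 3)
    (S : LeftInvariantSubRiemannian E G) (hS : S.IsContact) (b : Module.Basis (Fin 2) ℝ S.plane) :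
    ⁅(b 0 : GroupLieAlgebra 𝓘(ℝ, E) G), (b 1 : GroupLieAlgebra 𝓘(ℝ, E) G)⁆ ∉ S.plane := by
  have : FiniteDimensional ℝ (GroupLieAlgebra 𝓘(ℝ, E) G) :=
    inferInstanceAs (FiniteDimensional ℝ E)
  have hE' : Module.finrank ℝ (GroupLieAlgebra 𝓘(ℝ, E) G) = 3 := hE
  intro hmem
  have hlt : S.plane < ⊤ := by
    refine lt_top_iff_ne_top.2 fun htop => ?_
    have := hS.1
    rw [htop, finrank_top, hE'] at this
    omega
  obtain ⟨α, hα, hker⟩ := S.plane.exists_le_ker_of_lt_top hlt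
  obtain ⟨u, v, w, h⟩ := hS.2 α hα fun v hv => hker hv
  obtain ⟨f, hf⟩ : ∃ f, f ∉ S.plane := by
    by_contra! hall
    exact hlt.ne (eq_top_iff.2 fun x _ => hall x)
  have hli := S.linearIndependent_frame_append b hf
  obtain ⟨u₀, u₁, u₂, rfl⟩ := exists_coords_of_finrank_eq_three hE' hli u
  obtain ⟨v₀, v₁, v₂, rfl⟩ := exists_coords_of_finrank_eq_three hE' hli v
  obtain ⟨w₀, w₁, w₂, rfl⟩ := exists_coords_of_finrank_eq_three hE' hli w
  have e0 : α (b 0 : GroupLieAlgebra 𝓘(ℝ, E) G) = 0 := hker (b 0).2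
  have e1 : α (b 1 : GroupLieAlgebra 𝓘(ℝ, E) G) = 0 := hker (b 1).2
  have e2 : α ⁅(b 0 : GroupLieAlgebra 𝓘(ℝ, E) G), (b 1 : GroupLieAlgebra 𝓘(ℝ, E) G)⁆ = 0 :=
    hker hmem
  have e3 : α ⁅(b 1 : GroupLieAlgebra 𝓘(ℝ, E) G), (b 0 : GroupLieAlgebra 𝓘(ℝ, E) G)⁆ = 0 := by
    rw [← lie_skew, map_neg, e2, neg_zero]
  have e4 : α ⁅f, (b 0 : GroupLieAlgebra 𝓘(ℝ, E) G)⁆ =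
      -α ⁅(b 0 : GroupLieAlgebra 𝓘(ℝ, E) G), f⁆ := by rw [← lie_skew, map_neg]
  have e5 : α ⁅f, (b 1 : GroupLieAlgebra 𝓘(ℝ, E) G)⁆ =
      -α ⁅(b 1 : GroupLieAlgebra 𝓘(ℝ, E) G), f⁆ := by rw [← lie_skew, map_neg]
  refine h ?_
  simp only [contactForm, dForm, add_lie, lie_add, smul_lie, lie_smul, lie_self, map_add, map_smul,
    smul_eq_mul, e0, e1, e2, e3, e4, e5, map_zero]
  ring

end LeftInvariantSubRiemannian

end

theorem theorem5 {E : Type*} [NormedAddCommGroup E] [NormedSpace ℝ E] [FiniteDimensional ℝ E]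
    [MeasurableSpace E] [BorelSpace E] (hE : Module.finrank ℝ E = 3)
    {G : Type*} [TopologicalSpace G] [ChartedSpace E G] [Group G] [LieGroup 𝓘(ℝ, E) ω G]
    (S : LeftInvariantSubRiemannian E G) (hS : S.IsContact) :
    IsAnalyticallyIntegrable S.hamiltonian := by
  have : CompleteSpace E := FiniteDimensional.complete ℝ E
  have : FiniteDimensional ℝ (GroupLieAlgebra 𝓘(ℝ, E) G) :=
    inferInstanceAs (FiniteDimensional ℝ E)
  obtain ⟨b, hb⟩ := S.exists_orthonormal_frame hS.1
  have hli := S.linearIndependent_frame_append b (S.lie_notMem_plane hE hS b)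
  rw [S.hamiltonian_eq_quadraticIn hb]
  obtain ⟨u, v, huv, hind⟩ | ⟨p, q, r, h₀, h₁⟩ :=
    exists_commuting_pair_or_unimodular (L := GroupLieAlgebra 𝓘(ℝ, E) G) hE hli
  · exact isAnalyticallyIntegrable_of_commuting_pair hE hli huv hind
  · exact isAnalyticallyIntegrable_of_unimodular hE hli h₀ h₁
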